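/- Let $w_1,w_2,\dots$ be i.i.d. random variables, uniformly distributed on $(0,1]$, and for $\tau>0$ and $L\in\mathbb N$ put $v_{\tau,L}:=\prod_{k=1}^{L}(\tau w_k)$. 1. There are numbers $\tilde L$ ($L\ge 1$), depending on $L$ only, with $L-\tfrac13\le\tilde L\le L-1+\ln 2$, such that for all $\tau>0$ and $L\ge1$ the random variable $v_{\tau,L}$ has exactly one median, namely $\operatorname{median}[v_{\tau,L}]=e^{L\ln\tau-\tilde L}$. (A median of $X$ is a number $m$ with $P(X\le m)\ge\frac12$ and $P(X\ge m)\ge\frac12$.) 2. For $\tau=2$: $\operatorname{median}[v_{2,L}]\to0$ as $L\to\infty$, while $\mathbb E[v_{2,L}]=1$ for all $L$, $\mathbb E[v_{2,L}^2]<\infty$ for all $L$, and $\mathbb E[v_{2,L}^2]\to\infty$ as $L\to\infty$. 3. For $\tau=\sqrt3$: $\operatorname{median}[v_{\sqrt3,L}]\to0$ as $L\to\infty$, while $\mathbb E[v_{\sqrt3,L}^2]=1$ for all $L$. 4. For $\tau=e$ the median is stabilized: $e/2\le\operatorname{median}[v_{e,L}]\le e^{1/3}$ for all $L\ge1$. 5.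 For every $\tau>0$, almost surely $\lim_{L\to\infty}(v_{\tau,L})^{1/L}=\tau/e$, and hence, to first order in the exponent, $v_{\tau,L}=\exp\bigl(-L(1-\ln\tau)+o(L)\bigr)$ as $L\to\infty$. -/

import Mathlib

open MeasureTheory ProbabilityTheory Filter Topology Asymptotics

/-- The magnitude `v_{τ,L} = ∏ (τ w_k)` of the input-output map of a chain of depth `L`, where the
product runs over the first `L` weights (numbered from `0`). -/
noncomputable def chainMagnitude {Ω : Type*} (w : ℕ → Ω → ℝ) (τ : ℝ) (L : ℕ) (ω : Ω) : ℝ :=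
  ∏ k ∈ Finset.range L, (τ * w k ω)

/-- `m` is a median of the real random variable `X` under `P`:
`P(X ≤ m) ≥ 1/2` and `P(X ≥ m) ≥ 1/2`. -/
def IsMedian {Ω : Type*} [MeasurableSpace Ω] (P : Measure Ω) (X : Ω → ℝ) (m : ℝ) : Prop :=
  1 / 2 ≤ P.real {ω | X ω ≤ m} ∧ 1 / 2 ≤ P.real {ω | m ≤ X ω}

/-!
The variables `-log w k` are exponential of rate one, so `-log` of a product of `n + 1` weights has
the Erlang tail `Q n x = exp (-x) * ∑ k ≤ n, x ^ k / k!`, and the median exponent is the root of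
`Q n = 1 / 2`. By the central limit theorem `Q n (n + c) → 1 / 2` for every constant `c`.
The difference `Q (n + 1) (y + 1) - Q n y` has the sign of
`1 - ∫ t in 0..1, exp (-t) * (1 + t / y) ^ (n + 1)`; bounding the integrand below by `1 + x ≤ exp x`
and above by `exp x ≤ 1 + x + x ^ 2` for `|x| ≤ 1` shows that `Q n (n + 2 / 3)` decreases to
`1 / 2`, whereas `Q n (n + log 2)` increases to it for `n ≥ 6`; a numerical check covers the smaller
`n`. This traps the root in `[n + 2 / 3, n + log 2]`. The remaining claims follow from independence
and from the strong law of large numbers for `log w k`.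
-/

section LogBounds

lemma nonneg_of_hasDerivAt_nonneg {f f' : ℝ → ℝ} (hf : ∀ t, 0 ≤ t → HasDerivAt f (f' t) t)
    (hf₀ : 0 ≤ f 0) (hf' : ∀ t, 0 < t → 0 ≤ f' t) {u : ℝ} (hu : 0 ≤ u) : 0 ≤ f u := by
  have hmono : MonotoneOn f (Set.Ici 0) := by
    refine monotoneOn_of_hasDerivWithinAt_nonneg (f' := f') (convex_Ici 0)
      (fun t ht => (hf t ht).continuousAt.continuousWithinAt) (fun t ht => ?_) (fun t ht => ?_)
    · exact (hf t (interior_subset ht)).hasDerivWithinAt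
    · exact hf' t (by simpa using ht)
  exact hf₀.trans (hmono Set.self_mem_Ici hu hu)

lemma hasDerivAt_log_one_add {t : ℝ} (ht : 0 ≤ t) :
    HasDerivAt (fun t => Real.log (1 + t)) (1 + t)⁻¹ t := by
  simpa using ((hasDerivAt_id t).const_add 1).log (by simp only [id]; positivity)

lemma log_one_add_le {u : ℝ} (hu : 0 ≤ u) : Real.log (1 + u) ≤ u - u ^ 2 / 2 + u ^ 3 / 3 := by
  refine sub_nonneg.1 (nonneg_of_hasDerivAt_nonneg
    (f := fun t => t - t ^ 2 / 2 + t ^ 3 / 3 - Real.log (1 + t))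
    (f' := fun t => t ^ 3 / (1 + t)) (fun t ht => ?_) (by simp) (fun t ht => by positivity) hu)
  refine HasDerivAt.congr_deriv ((((hasDerivAt_id t).sub ((hasDerivAt_pow 2 t).div_const 2)).add
    ((hasDerivAt_pow 3 t).div_const 3)).sub (hasDerivAt_log_one_add ht)) ?_
  have : 1 + t ≠ 0 := by positivity
  push_cast
  field_simp
  ring

-- The left side agrees with the logarithm to third order and, at `u = 1 / y`, becomes
-- `(1 + 1 / (2 * (y + 1 / 3))) / (y + 1)`.
lemma le_log_one_add {u : ℝ} (hu : 0 ≤ u) :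
    u * (6 + 5 * u) / (2 * (3 + u) * (1 + u)) ≤ Real.log (1 + u) := by
  refine sub_nonneg.1 (nonneg_of_hasDerivAt_nonneg
    (f := fun t => Real.log (1 + t) - t * (6 + 5 * t) / (2 * (3 + t) * (1 + t)))
    (f' := fun t => t ^ 3 / ((3 + t) ^ 2 * (1 + t) ^ 2)) (fun t ht => ?_) (by simp)
    (fun t ht => by positivity) hu)
  have hnum := (hasDerivAt_id t).mul (((hasDerivAt_id t).const_mul 5).const_add 6)
  have hden := (((hasDerivAt_id t).const_add 3).const_mul 2).mul ((hasDerivAt_id t).const_add 1)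
  refine HasDerivAt.congr_deriv ((hasDerivAt_log_one_add ht).sub
    (hnum.div hden (by positivity))) ?_
  have h1 : 1 + t ≠ 0 := by positivity
  have h3 : 3 + t ≠ 0 := by positivity
  simp only [id, Pi.mul_apply]
  field_simp
  ring

lemma one_add_le_mul_log_one_add_inv {y : ℝ} (hy : 0 < y) :
    1 + 1 / (2 * (y + 1 / 3)) ≤ (y + 1) * Real.log (1 + 1 / y) := by
  calc 1 + 1 / (2 * (y + 1 / 3))
      = (y + 1) * (1 / y * (6 + 5 * (1 / y)) / (2 * (3 + 1 / y) * (1 + 1 / y))) := by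
        field_simp
        ring
    _ ≤ (y + 1) * Real.log (1 + 1 / y) := by
        gcongr
        exact le_log_one_add (by positivity)

end LogBounds

section ErlangTail

/-- The probability that a sum of `n + 1` independent exponential variables of rate one exceeds
`x ≥ 0`, that is, the regularized incomplete Gamma function `Γ(n + 1, x) / n!`. -/
noncomputable def erlangTail (n : ℕ) (x : ℝ) : ℝ :=
  Real.exp (-x) * ∑ k ∈ Finset.range (n + 1), x ^ k / (k.factorial : ℝ)

lemma erlangTail_zero_left (x : ℝ) : erlangTail 0 x = Real.exp (-x) := by
  simp [erlangTail]

lemma erlangTail_zero_right (n : ℕ) : erlangTail n 0 = 1 := by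
  simp [erlangTail, Finset.sum_range_succ']

lemma erlangTail_succ (n : ℕ) (x : ℝ) :
    erlangTail (n + 1) x =
      erlangTail n x + Real.exp (-x) * (x ^ (n + 1) / ((n + 1).factorial : ℝ)) := by
  rw [erlangTail, Finset.sum_range_succ, mul_add, ← erlangTail]

lemma hasDerivAt_erlangTail (n : ℕ) (x : ℝ) :
    HasDerivAt (erlangTail n) (-(Real.exp (-x) * (x ^ n / (n.factorial : ℝ)))) x := by
  have hexp : HasDerivAt (fun x : ℝ => Real.exp (-x)) (-Real.exp (-x)) x := by
    simpa using (hasDerivAt_neg x).exp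
  induction n with
  | zero => simpa [funext erlangTail_zero_left] using hexp
  | succ n ih =>
    rw [funext (erlangTail_succ n)]
    refine (ih.add (hexp.mul ((hasDerivAt_pow (n + 1) x).div_const _))).congr_deriv ?_
    have hfact : (n.factorial : ℝ) ≠ 0 := by positivity
    rw [Nat.factorial_succ]
    push_cast
    field_simp
    simp

lemma continuous_erlangTail (n : ℕ) : Continuous (erlangTail n) :=
  continuous_iff_continuousAt.2 fun x => (hasDerivAt_erlangTail n x).continuousAt

lemma strictAntiOn_erlangTail (n : ℕ) : StrictAntiOn (erlangTail n) (Set.Ici 0) := by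
  refine strictAntiOn_of_deriv_neg (convex_Ici 0) (continuous_erlangTail n).continuousOn
    fun x hx => ?_
  have hx : 0 < x := by simpa using hx
  rw [(hasDerivAt_erlangTail n x).deriv]
  exact neg_neg_of_pos (by positivity)

lemma erlangTail_succ_add_one_sub_eq (n : ℕ) {y : ℝ} (hy : 0 < y) :
    erlangTail (n + 1) (y + 1) - erlangTail n y =
      Real.exp (-y) * (y ^ (n + 1) / ((n + 1).factorial : ℝ)) *
        (1 - ∫ t in (0 : ℝ)..1, Real.exp (-t) * (1 + t / y) ^ (n + 1)) := by
  have hderiv : ∀ t : ℝ, HasDerivAt (fun t => erlangTail (n + 1) (y + t))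
      (-(Real.exp (-y) * (y ^ (n + 1) / ((n + 1).factorial : ℝ))) *
        (Real.exp (-t) * (1 + t / y) ^ (n + 1))) t := fun t => by
    refine ((hasDerivAt_erlangTail (n + 1) (y + t)).comp_const_add y t).congr_deriv ?_
    rw [neg_add, Real.exp_add, one_add_div hy.ne', div_pow]
    field_simp
  have hftc := intervalIntegral.integral_eq_sub_of_hasDerivAt (a := 0) (b := 1)
    (fun t _ => hderiv t) (Continuous.intervalIntegrable (by fun_prop) _ _)
  rw [intervalIntegral.integral_const_mul, add_zero, erlangTail_succ n y] at hftc
  linarith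

lemma erlangTail_succ_add_one_le_iff (n : ℕ) {y : ℝ} (hy : 0 < y) :
    erlangTail (n + 1) (y + 1) ≤ erlangTail n y ↔
      1 ≤ ∫ t in (0 : ℝ)..1, Real.exp (-t) * (1 + t / y) ^ (n + 1) := by
  rw [← sub_nonpos, erlangTail_succ_add_one_sub_eq n hy,
    mul_nonpos_iff_pos_imp_nonpos, sub_nonpos]
  exact ⟨fun h => h.1 (by positivity), fun h => ⟨fun _ => h, fun _ => by positivity⟩⟩

lemma le_erlangTail_succ_add_one_iff (n : ℕ) {y : ℝ} (hy : 0 < y) :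
    erlangTail n y ≤ erlangTail (n + 1) (y + 1) ↔
      ∫ t in (0 : ℝ)..1, Real.exp (-t) * (1 + t / y) ^ (n + 1) ≤ 1 := by
  rw [← sub_nonneg, erlangTail_succ_add_one_sub_eq n hy,
    mul_nonneg_iff_of_pos_left (by positivity), sub_nonneg]

lemma exp_neg_mul_pow_eq_exp (n : ℕ) {y t : ℝ} (hy : 0 < y) (ht : 0 ≤ t) :
    Real.exp (-t) * (1 + t / y) ^ n = Real.exp (n * Real.log (1 + t / y) - t) := by
  rw [sub_eq_neg_add, Real.exp_add, Real.exp_nat_mul, Real.exp_log (by positivity)]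

lemma integral_log_one_add_div {y : ℝ} (hy : 0 < y) :
    ∫ t in (0 : ℝ)..1, Real.log (1 + t / y) = (y + 1) * Real.log (1 + 1 / y) - 1 := by
  have := intervalIntegral.integral_comp_add_div (a := 0) (b := 1) Real.log hy.ne' 1
  rw [this, integral_log]
  simp
  field_simp
  ring

lemma erlangTail_succ_add_one_le {n : ℕ} {y : ℝ} (hy : 0 < y) (hyn : y ≤ n + 2 / 3) :
    erlangTail (n + 1) (y + 1) ≤ erlangTail n y := by
  rw [erlangTail_succ_add_one_le_iff n hy]
  have hlog_int : IntervalIntegrable (fun t : ℝ => Real.log (1 + t / y)) volume 0 1 := by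
    refine ContinuousOn.intervalIntegrable fun t ht => ContinuousAt.continuousWithinAt ?_
    rw [Set.uIcc_of_le zero_le_one] at ht
    have : 1 + t / y ≠ 0 := by have := ht.1; positivity
    fun_prop (disch := assumption)
  have hlin_int : IntervalIntegrable (fun t : ℝ => 1 - t) volume 0 1 :=
    Continuous.intervalIntegrable (by fun_prop) _ _
  calc (1 : ℝ)
      ≤ 1 / 2 + (n + 1) * ((y + 1) * Real.log (1 + 1 / y) - 1) := by
        have hlog := one_add_le_mul_log_one_add_inv hy
        have : (1 : ℝ) / 2 ≤ (n + 1) * (1 / (2 * (y + 1 / 3))) := by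
          rw [mul_one_div, div_le_div_iff₀ two_pos (by positivity)]
          linarith
        nlinarith
    _ = ∫ t in (0 : ℝ)..1, ((1 - t) + (n + 1) * Real.log (1 + t / y)) := by
        rw [intervalIntegral.integral_add hlin_int (hlog_int.const_mul _),
          intervalIntegral.integral_const_mul, integral_log_one_add_div hy,
          intervalIntegral.integral_sub intervalIntegrable_const
            intervalIntegral.intervalIntegrable_id,
          intervalIntegral.integral_const, integral_id]
        norm_num
    _ ≤ ∫ t in (0 : ℝ)..1, Real.exp (-t) * (1 + t / y) ^ (n + 1) := by
        refine intervalIntegral.integral_mono_on zero_le_one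
          (hlin_int.add (hlog_int.const_mul _))
          (Continuous.intervalIntegrable (by fun_prop) _ _) fun t ht => ?_
        rw [exp_neg_mul_pow_eq_exp _ hy ht.1]
        push_cast
        linarith [Real.add_one_le_exp ((n + 1) * Real.log (1 + t / y) - t)]

lemma integral_cubic (a b c d : ℝ) :
    ∫ t in (0 : ℝ)..1, (a + b * t + c * t ^ 2 + d * t ^ 3) = a + b / 2 + c / 3 + d / 4 := by
  have hderiv (t : ℝ) : HasDerivAt
      (fun t : ℝ => a * t + b * t ^ 2 / 2 + c * t ^ 3 / 3 + d * t ^ 4 / 4)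
      (a + b * t + c * t ^ 2 + d * t ^ 3) t := by
    refine HasDerivAt.congr_deriv (((((hasDerivAt_id t).const_mul a).add
      (((hasDerivAt_pow 2 t).const_mul b).div_const 2)).add
      (((hasDerivAt_pow 3 t).const_mul c).div_const 3)).add
      (((hasDerivAt_pow 4 t).const_mul d).div_const 4)) ?_
    push_cast
    ring
  rw [intervalIntegral.integral_eq_sub_of_hasDerivAt (fun t _ => hderiv t)
    (Continuous.intervalIntegrable (by fun_prop) _ _)]
  ring

lemma mul_log_one_add_div_sub_le {a c y t : ℝ} (hy : 0 < y) (hc : 0 ≤ c) (ha : a ≤ y + c)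
    (ht : 0 ≤ t) :
    a * Real.log (1 + t / y) - t ≤
      c * y⁻¹ * t - (y⁻¹ + c * y⁻¹ ^ 2) / 2 * t ^ 2 + (y⁻¹ ^ 2 + c * y⁻¹ ^ 3) / 3 * t ^ 3 := by
  calc a * Real.log (1 + t / y) - t
      ≤ (y + c) * (t / y - (t / y) ^ 2 / 2 + (t / y) ^ 3 / 3) - t := by
        gcongr
        · exact Real.log_nonneg (le_add_of_nonneg_right (by positivity))
        · exact log_one_add_le (by positivity)
    _ = _ := by
        field_simp
        ring

lemma exp_cubic_le {r t : ℝ} (hr₀ : 0 ≤ r) (hr : r ≤ 3 / 20) (ht₀ : 0 ≤ t) (ht : t ≤ 1) :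
    Real.exp (31 / 100 * r * t - (r + 31 / 100 * r ^ 2) / 2 * t ^ 2 +
        (r ^ 2 + 31 / 100 * r ^ 3) / 3 * t ^ 3) ≤
      (1 + r ^ 2 / 25) + 31 / 100 * r * t + -((r + 31 / 100 * r ^ 2) / 2) * t ^ 2 +
        (r ^ 2 + 31 / 100 * r ^ 3) / 3 * t ^ 3 := by
  set E := 31 / 100 * r * t - (r + 31 / 100 * r ^ 2) / 2 * t ^ 2 +
    (r ^ 2 + 31 / 100 * r ^ 3) / 3 * t ^ 3 with hE
  have hfactor : E = r * ((31 / 100 * t - t ^ 2 / 2) + r * (t ^ 3 / 3 - 31 / 200 * t ^ 2) +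
      31 / 300 * (r ^ 2 * t ^ 3)) := by rw [hE]; ring
  have hbound : |E| ≤ r / 5 := by
    have hlin : -(19 / 100) ≤ 31 / 100 * t - t ^ 2 / 2 ∧ 31 / 100 * t - t ^ 2 / 2 ≤ 1 / 20 :=
      ⟨by nlinarith, by nlinarith [sq_nonneg (t - 31 / 100)]⟩
    have hquad : -(1 / 100) ≤ t ^ 3 / 3 - 31 / 200 * t ^ 2 ∧
        t ^ 3 / 3 - 31 / 200 * t ^ 2 ≤ 1 / 5 :=
      ⟨by nlinarith [mul_nonneg ht₀ (sq_nonneg (t - 3 / 10)), sq_nonneg (t - 3 / 10)],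
        by nlinarith [pow_le_one₀ ht₀ ht (n := 3), sq_nonneg t]⟩
    have hcubic : r ^ 2 * t ^ 3 ≤ (3 / 20) ^ 2 * 1 ^ 3 := by gcongr
    have hcubic₀ : 0 ≤ r ^ 2 * t ^ 3 := by positivity
    rw [hfactor, abs_mul, abs_of_nonneg hr₀, div_eq_mul_inv]
    refine mul_le_mul_of_nonneg_left (abs_le.2 ⟨?_, ?_⟩) hr₀ <;> nlinarith
  have hone : |E| ≤ 1 := by linarith
  have hexp := (abs_le.1 (Real.abs_exp_sub_one_sub_id_le hone)).2
  have hsq : E ^ 2 ≤ r ^ 2 / 25 := by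
    calc E ^ 2 = |E| ^ 2 := (sq_abs E).symm
      _ ≤ (r / 5) ^ 2 := by gcongr
      _ = r ^ 2 / 25 := by ring
  linarith

-- Any constant strictly between `2 / 3` and `log 2` could replace `69 / 100`, with `31 / 100` above
-- being its complement to one and the lower bound on `y` adapted.
lemma le_erlangTail_succ_add_one {n : ℕ} {y : ℝ} (hy : 20 / 3 ≤ y) (hyn : n + 69 / 100 ≤ y) :
    erlangTail n y ≤ erlangTail (n + 1) (y + 1) := by
  have hy₀ : 0 < y := by linarith
  rw [le_erlangTail_succ_add_one_iff n hy₀]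
  have hinv : y⁻¹ ≤ 3 / 20 := by
    simpa using inv_anti₀ (by norm_num) hy
  calc ∫ t in (0 : ℝ)..1, Real.exp (-t) * (1 + t / y) ^ (n + 1)
      ≤ ∫ t in (0 : ℝ)..1, ((1 + y⁻¹ ^ 2 / 25) + 31 / 100 * y⁻¹ * t +
          -((y⁻¹ + 31 / 100 * y⁻¹ ^ 2) / 2) * t ^ 2 +
          (y⁻¹ ^ 2 + 31 / 100 * y⁻¹ ^ 3) / 3 * t ^ 3) := by
        refine intervalIntegral.integral_mono_on zero_le_one
          (Continuous.intervalIntegrable (by fun_prop) _ _)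
          (Continuous.intervalIntegrable (by fun_prop) _ _) fun t ht => ?_
        rw [exp_neg_mul_pow_eq_exp _ hy₀ ht.1]
        refine (Real.exp_le_exp.2 (mul_log_one_add_div_sub_le hy₀ (by norm_num) ?_ ht.1)).trans
          (exp_cubic_le (by positivity) hinv ht.1 ht.2)
        push_cast
        linarith
    _ ≤ 1 := by
        have hinv₀ : 0 < y⁻¹ := by positivity
        rw [integral_cubic]
        have : y⁻¹ ^ 3 ≤ y⁻¹ * (3 / 20) ^ 2 := by
          rw [pow_succ']
          gcongr
        nlinarith

end ErlangTail

section Convolution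

lemma erlangTail_nonneg (n : ℕ) {x : ℝ} (hx : 0 ≤ x) : 0 ≤ erlangTail n x := by
  unfold erlangTail
  positivity

lemma erlangTail_le_one (n : ℕ) {x : ℝ} (hx : 0 ≤ x) : erlangTail n x ≤ 1 :=
  erlangTail_zero_right n ▸ (strictAntiOn_erlangTail n).antitoneOn Set.self_mem_Ici hx hx

lemma norm_erlangTail_max_zero_le_one (n : ℕ) (x : ℝ) : ‖erlangTail n (max x 0)‖ ≤ 1 := by
  rw [Real.norm_of_nonneg (erlangTail_nonneg n (le_max_right x 0))]
  exact erlangTail_le_one n (le_max_right x 0)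

lemma hasDerivAt_mul_erlangTail_log (n : ℕ) {x b : ℝ} (hb : 0 < b) :
    HasDerivAt (fun b => b * erlangTail (n + 1) (x + Real.log b)) (erlangTail n (x + Real.log b))
      b := by
  have hlog : HasDerivAt (fun b => x + Real.log b) b⁻¹ b :=
    (Real.hasDerivAt_log hb.ne').const_add x
  refine ((hasDerivAt_id b).mul ((hasDerivAt_erlangTail (n + 1) _).comp b hlog)).congr_deriv ?_
  simp only [id, Function.comp_apply, erlangTail_succ]
  field_simp
  ring

lemma hasDerivAt_mul_erlangTail_max_log (n : ℕ) {x b : ℝ} (hb : 0 < b)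
    (hxb : x + Real.log b ≠ 0) :
    HasDerivAt (fun b => b * erlangTail (n + 1) (max (x + Real.log b) 0))
      (erlangTail n (max (x + Real.log b) 0)) b := by
  have hcont : ContinuousAt (fun b => x + Real.log b) b := by
    fun_prop (disch := exact hb.ne')
  rcases hxb.lt_or_gt with hneg | hpos
  · rw [max_eq_right hneg.le, erlangTail_zero_right]
    refine (hasDerivAt_id b).congr_of_eventuallyEq ?_
    filter_upwards [hcont.eventually_lt_const hneg] with c hc
    rw [max_eq_right hc.le, erlangTail_zero_right, mul_one, id]
  · rw [max_eq_left hpos.le]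
    refine (hasDerivAt_mul_erlangTail_log n hb).congr_of_eventuallyEq ?_
    filter_upwards [hcont.eventually_const_lt hpos] with c hc
    rw [max_eq_left hc.le]

lemma continuousAt_mul_erlangTail_max_log (n : ℕ) (x b : ℝ) :
    ContinuousAt (fun b => b * erlangTail n (max (x + Real.log b) 0)) b := by
  rcases eq_or_ne b 0 with rfl | hb
  · rw [ContinuousAt, zero_mul]
    refine squeeze_zero_norm (a := fun b => ‖b‖) (fun b => ?_) tendsto_norm_zero
    rw [norm_mul]
    exact mul_le_of_le_one_right (norm_nonneg b) (norm_erlangTail_max_zero_le_one n _)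
  · have := continuous_erlangTail n
    fun_prop (disch := exact hb)

lemma integral_erlangTail_max_log (n : ℕ) (x : ℝ) :
    ∫ b in (0 : ℝ)..1, erlangTail n (max (x + Real.log b) 0) = erlangTail (n + 1) (max x 0) := by
  have hint : IntervalIntegrable (fun b => erlangTail n (max (x + Real.log b) 0)) volume 0 1 := by
    have hmeas : Measurable fun b => erlangTail n (max (x + Real.log b) 0) :=
      (continuous_erlangTail n).measurable.comp (by fun_prop)
    exact (intervalIntegrable_const (c := (1 : ℝ))).mono_fun hmeas.aestronglyMeasurable
      (ae_of_all _ fun b => by simpa using norm_erlangTail_max_zero_le_one n _)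
  rw [integral_eq_of_hasDerivAt_off_countable_of_le
    (fun b => b * erlangTail (n + 1) (max (x + Real.log b) 0)) _ zero_le_one
    (Set.countable_singleton (Real.exp (-x)))
    (fun b _ => (continuousAt_mul_erlangTail_max_log _ x b).continuousWithinAt)
    (fun b hb => hasDerivAt_mul_erlangTail_max_log n hb.1.1 fun h => hb.2 ?_) hint]
  · simp
  · rw [Set.mem_singleton_iff, ← Real.log_injOn_pos.eq_iff hb.1.1 (Real.exp_pos _), Real.log_exp]
    linarith

end Convolution

section UnitUniform

/-- The uniform distribution on `(0, 1]`. -/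
noncomputable abbrev unitUniform : Measure ℝ := volume.restrict (Set.Ioc 0 1)

instance : IsProbabilityMeasure unitUniform := ⟨by simp⟩

variable {Ω : Type*} [MeasurableSpace Ω] {P : Measure Ω} {u v : Ω → ℝ} {w : ℕ → Ω → ℝ}

lemma hasLaw_unitUniform_of_isUniform (hu : pdf.IsUniform u (Set.Ioc (0 : ℝ) 1) P volume) :
    HasLaw u unitUniform P where
  aemeasurable := hu.aemeasurable (by simp) (by simp)
  map_eq := by
    rw [hu, ProbabilityTheory.cond]
    simp

lemma ae_mem_Ioc_of_hasLaw (hu : HasLaw u unitUniform P) :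
    ∀ᵐ ω ∂P, u ω ∈ Set.Ioc (0 : ℝ) 1 :=
  (hu.ae_iff measurableSet_Ioc.mem).2 (ae_restrict_mem measurableSet_Ioc)

lemma integral_comp_of_hasLaw (hu : HasLaw u unitUniform P) {f : ℝ → ℝ}
    (hf : AEStronglyMeasurable f unitUniform) :
    ∫ ω, f (u ω) ∂P = ∫ x in (0 : ℝ)..1, f x :=
  (hu.integral_comp hf).trans (intervalIntegral.integral_of_le zero_le_one).symm

lemma measureReal_mul_le (hu : HasLaw u unitUniform P) (hv : AEMeasurable v P)
    (hind : IndepFun v u P) (z : ℝ) :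
    P.real {ω | v ω * u ω ≤ z} = ∫ b in (0 : ℝ)..1, P.real {ω | v ω ≤ z / b} := by
  have := hu.isProbabilityMeasure
  have hs : MeasurableSet {p : ℝ × ℝ | p.1 * p.2 ≤ z} :=
    measurableSet_le (by fun_prop) measurable_const
  have hlaw : HasLaw (fun ω => (v ω, u ω)) ((P.map v).prod unitUniform) P :=
    ⟨hv.prodMk hu.aemeasurable, by
      rw [hind.map_prod_eq_prod_map_map hv hu.aemeasurable, hu.map_eq]⟩
  rw [hlaw.measureReal_eq (p := fun p => p.1 * p.2 ≤ z) hs, Measure.real,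
    Measure.prod_apply_symm hs, ← integral_toReal
      (measurable_measure_prodMk_right hs).aemeasurable (ae_of_all _ fun _ => measure_lt_top _ _),
    intervalIntegral.integral_of_le zero_le_one]
  refine setIntegral_congr_fun measurableSet_Ioc fun b hb => ?_
  have hsection : (fun a => (a, b)) ⁻¹' {p : ℝ × ℝ | p.1 * p.2 ≤ z} = Set.Iic (z / b) := by
    ext a
    simp [le_div_iff₀ hb.1]
  rw [hsection, Measure.map_apply_of_aemeasurable hv measurableSet_Iic]
  rfl

lemma measureReal_le_exp_neg (hu : HasLaw u unitUniform P) (x : ℝ) :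
    P.real {ω | u ω ≤ Real.exp (-x)} = Real.exp (-max x 0) := by
  have hmin : Real.exp (-max x 0) = min 1 (Real.exp (-x)) := by
    rw [max_comm, ← min_neg_neg, Real.exp_monotone.map_min, neg_zero, Real.exp_zero]
  calc P.real {ω | u ω ≤ Real.exp (-x)}
      = unitUniform.real (Set.Iic (Real.exp (-x))) := hu.measureReal_eq measurableSet_Iic
    _ = volume.real (Set.Ioc 0 (min 1 (Real.exp (-x)))) := by
        rw [measureReal_restrict_apply measurableSet_Iic, Set.inter_comm, Set.Ioc_inter_Iic]
    _ = Real.exp (-max x 0) := by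
        rw [hmin, Real.volume_real_Ioc_of_le (by positivity), sub_zero]

lemma measureReal_prod_le_exp_neg (hw : ∀ k, HasLaw (w k) unitUniform P) (hindep : iIndepFun w P)
    (n : ℕ) (x : ℝ) :
    P.real {ω | ∏ k ∈ Finset.range (n + 1), w k ω ≤ Real.exp (-x)} = erlangTail n (max x 0) := by
  induction n generalizing x with
  | zero => simpa [erlangTail_zero_left] using measureReal_le_exp_neg (hw 0) x
  | succ n ih =>
    have hind := hindep.indepFun_prod_range_succ₀ (fun k => (hw k).aemeasurable) (n + 1)
    rw [Finset.prod_fn] at hind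
    simp_rw [Finset.prod_range_succ _ (n + 1)]
    rw [measureReal_mul_le (hw (n + 1))
      (Finset.aemeasurable_fun_prod _ fun k _ => (hw k).aemeasurable) hind,
      ← integral_erlangTail_max_log]
    refine intervalIntegral.integral_congr_ae (ae_of_all _ fun b hb => ?_)
    rw [Set.uIoc_of_le zero_le_one] at hb
    rw [← ih, neg_add, Real.exp_add, Real.exp_neg (Real.log b), Real.exp_log hb.1, div_eq_mul_inv]

end UnitUniform

section Median

variable {Ω : Type*} [MeasurableSpace Ω] {P : Measure Ω} {X : Ω → ℝ} {w : ℕ → Ω → ℝ} {m : ℝ}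

lemma isMedian_const_mul_iff {c : ℝ} (hc : 0 < c) :
    IsMedian P (fun ω => c * X ω) m ↔ IsMedian P X (m / c) := by
  simp only [IsMedian, le_div_iff₀ hc, div_le_iff₀ hc, mul_comm c]

lemma pos_of_isMedian_of_ae_pos (hm : IsMedian P X m) (hX : ∀ᵐ ω ∂P, 0 < X ω) : 0 < m := by
  by_contra! hm₀
  have hnull : P {ω | X ω ≤ m} = 0 := by
    simpa only [not_lt] using ae_iff.1 (hX.mono fun ω hω => hm₀.trans_lt hω)
  have hhalf := hm.1
  rw [measureReal_def, hnull] at hhalf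
  norm_num at hhalf

lemma measureReal_lt_eq_measureReal_le [IsFiniteMeasure P]
    (hm : ContinuousAt (fun z => P.real {ω | X ω ≤ z}) m) :
    P.real {ω | X ω < m} = P.real {ω | X ω ≤ m} := by
  refine le_antisymm (measureReal_mono (Set.ofPred_subset_ofPred.2 fun ω hω => hω.le)) ?_
  refine le_of_tendsto (hm.tendsto.mono_left (nhdsWithin_le_nhds (s := Set.Iio m))) ?_
  filter_upwards [self_mem_nhdsWithin] with z hz
  exact measureReal_mono (Set.ofPred_subset_ofPred.2 fun ω hω => hω.trans_lt hz)

lemma isMedian_iff_measureReal_le_eq_half [IsProbabilityMeasure P] (hX : AEMeasurable X P)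
    (hm : ContinuousAt (fun z => P.real {ω | X ω ≤ z}) m) :
    IsMedian P X m ↔ P.real {ω | X ω ≤ m} = 1 / 2 := by
  have hcompl : P.real {ω | m ≤ X ω} = 1 - P.real {ω | X ω ≤ m} := by
    rw [← measureReal_lt_eq_measureReal_le hm,
      ← probReal_compl_eq_one_sub₀ (nullMeasurableSet_lt hX aemeasurable_const)]
    simp only [Set.compl_ofPred, not_lt]
  rw [IsMedian, hcompl]
  constructor
  · rintro ⟨hle, hge⟩
    linarith
  · intro h
    constructor <;> linarith

lemma continuousAt_measureReal_prod_le (hw : ∀ k, HasLaw (w k) unitUniform P)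
    (hindep : iIndepFun w P) (n : ℕ) (hm : 0 < m) :
    ContinuousAt (fun z => P.real {ω | ∏ k ∈ Finset.range (n + 1), w k ω ≤ z}) m := by
  have hcont : ContinuousAt (fun z => erlangTail n (max (-Real.log z) 0)) m := by
    have := continuous_erlangTail n
    fun_prop (disch := exact hm.ne')
  refine hcont.congr ?_
  filter_upwards [lt_mem_nhds hm] with z hz
  rw [← measureReal_prod_le_exp_neg hw hindep, neg_neg, Real.exp_log hz]

lemma erlangTail_max_zero_eq_iff {n : ℕ} {x y : ℝ} (hx : 0 < x) :
    erlangTail n (max y 0) = erlangTail n x ↔ y = x := by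
  rw [(strictAntiOn_erlangTail n).injOn.eq_iff (le_max_right y 0) hx.le]
  grind

lemma isMedian_prod_iff (hw : ∀ k, HasLaw (w k) unitUniform P) (hindep : iIndepFun w P) {n : ℕ}
    {x : ℝ} (hx : 0 < x) (hxn : erlangTail n x = 1 / 2) :
    IsMedian P (fun ω => ∏ k ∈ Finset.range (n + 1), w k ω) m ↔ m = Real.exp (-x) := by
  have := (hw 0).isProbabilityMeasure
  have hpos : ∀ᵐ ω ∂P, 0 < ∏ k ∈ Finset.range (n + 1), w k ω := by
    filter_upwards [ae_all_iff.2 fun k => ae_mem_Ioc_of_hasLaw (hw k)] with ω hω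
    exact Finset.prod_pos fun k _ => (hω k).1
  suffices h : 0 < m → (IsMedian P (fun ω => ∏ k ∈ Finset.range (n + 1), w k ω) m ↔
      m = Real.exp (-x)) from
    ⟨fun hm => (h (pos_of_isMedian_of_ae_pos hm hpos)).1 hm,
      fun hm => (h (hm ▸ Real.exp_pos _)).2 hm⟩
  intro hm
  have hmeas : AEMeasurable (fun ω => ∏ k ∈ Finset.range (n + 1), w k ω) P :=
    Finset.aemeasurable_fun_prod _ fun k _ => (hw k).aemeasurable
  rw [isMedian_iff_measureReal_le_eq_half hmeas (continuousAt_measureReal_prod_le hw hindep n hm),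
    ← hxn]
  obtain ⟨y, rfl⟩ : ∃ y, Real.exp (-y) = m := ⟨-Real.log m, by rw [neg_neg, Real.exp_log hm]⟩
  rw [measureReal_prod_le_exp_neg hw hindep, erlangTail_max_zero_eq_iff hx, Real.exp_eq_exp,
    neg_inj]

end Median

section CentralLimit

variable {Ω : Type*} [MeasurableSpace Ω] {P : Measure Ω} {X : Ω → ℝ} {Y : ℕ → Ω → ℝ}

lemma measureReal_Iic_eq_half_of_map_neg_eq {μ : Measure ℝ} [IsProbabilityMeasure μ]
    [NullSingletonClass μ] (hneg : μ.map (fun x => -x) = μ) : μ.real (Set.Iic 0) = 1 / 2 := by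
  have hreflect : μ.real (Set.Iic 0) = μ.real (Set.Ioi 0) := by
    conv_lhs => rw [← hneg]
    rw [map_measureReal_apply measurable_neg measurableSet_Iic,
      ← measureReal_congr Ioi_ae_eq_Ici.symm]
    simp
  have hcompl := probReal_add_probReal_compl (μ := μ) (s := Set.Iic (0 : ℝ)) measurableSet_Iic
  rw [Set.compl_Iic, ← hreflect] at hcompl
  linarith

lemma tendsto_measureReal_le_zero_of_tendstoInDistribution {Z : ℕ → Ω → ℝ} [IsProbabilityMeasure P]
    {μ : Measure ℝ} [IsProbabilityMeasure μ] [NullSingletonClass μ]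
    (hZ : TendstoInDistribution Z atTop id (fun _ => P) μ) :
    Tendsto (fun n => P.real {ω | Z n ω ≤ 0}) atTop (𝓝 (μ.real (Set.Iic 0))) := by
  have h := ProbabilityMeasure.tendsto_measure_of_null_frontier_of_tendsto' hZ.tendsto
    (E := Set.Iic (0 : ℝ)) (by simp)
  simp only [ProbabilityMeasure.coe_mk, Measure.map_id] at h
  refine ((ENNReal.tendsto_toReal (measure_ne_top _ _)).comp h).congr fun n => ?_
  rw [Function.comp_apply]
  rw [Measure.map_apply_of_aemeasurable (hZ.forall_aemeasurable n) measurableSet_Iic]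
  rfl

lemma tendsto_measureReal_sum_le_mul_integral_add [IsProbabilityMeasure P]
    (hY : MemLp (Y 0) 2 P) (hvar : Var[Y 0; P] ≠ 0) (hindep : iIndepFun Y P)
    (hident : ∀ i, IdentDistrib (Y i) (Y 0) P P) (c : ℝ) :
    Tendsto (fun n : ℕ => P.real {ω | ∑ k ∈ Finset.range n, Y k ω ≤ n * P[Y 0] + c}) atTop
      (𝓝 (1 / 2)) := by
  have hv : Var[Y 0; P].toNNReal ≠ 0 :=
    (Real.toNNReal_pos.2 ((variance_nonneg _ _).lt_of_ne' hvar)).ne'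
  have := nullSingletonClass_gaussianReal (μ := 0) hv
  have hclt := tendstoInDistribution_inv_sqrt_mul_sum_sub (P := P) HasLaw.id hY hindep hident
  have hshift : TendstoInMeasure P (fun (n : ℕ) (_ : Ω) => (√(n : ℝ))⁻¹ * -c) atTop
      (fun _ => (0 : ℝ)) := by
    refine tendstoInMeasure_of_tendsto_ae (fun _ => aestronglyMeasurable_const) (ae_of_all _ ?_)
    have : Tendsto (fun n : ℕ => (√(n : ℝ))⁻¹) atTop (𝓝 0) :=
      tendsto_inv_atTop_zero.comp (Real.tendsto_sqrt_atTop.comp tendsto_natCast_atTop_atTop)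
    simpa using fun _ => this.mul_const (-c)
  have hsum := hclt.add_of_tendstoInMeasure_const hshift fun _ => aemeasurable_const
  simp only [add_zero] at hsum
  have hlim := tendsto_measureReal_le_zero_of_tendstoInDistribution hsum
  rw [measureReal_Iic_eq_half_of_map_neg_eq (by simp [gaussianReal_map_neg])] at hlim
  refine hlim.congr' ?_
  filter_upwards [eventually_gt_atTop 0] with n hn
  congr 1
  ext ω
  have : 0 < (√(n : ℝ))⁻¹ := by positivity
  simp only [Set.mem_ofPred_eq, Pi.add_apply]
  rw [← mul_add, mul_nonpos_iff_pos_imp_nonpos]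
  grind

lemma memLp_log_unitUniform (p : NNReal) : MemLp Real.log p unitUniform := by
  refine memLp_of_mem_interior_integrableExpSet (mem_interior_iff_mem_nhds.2 ?_) p
  filter_upwards [Ioi_mem_nhds (show (-1 : ℝ) < 0 by norm_num)] with t ht
  have hrpow : IntegrableOn (fun x : ℝ => x ^ t) (Set.Ioc 0 1) :=
    (intervalIntegrable_iff_integrableOn_Ioc_of_le zero_le_one).1
      (intervalIntegral.intervalIntegrable_rpow' ht)
  refine hrpow.congr_fun (fun x hx => ?_) measurableSet_Ioc
  exact (Real.rpow_def_of_pos hx.1 t).trans (by rw [mul_comm])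

lemma variance_log_unitUniform_ne_zero : Var[Real.log; unitUniform] ≠ 0 := by
  intro hvar
  have hconst := ae_eq_integral_of_variance_eq_zero (memLp_log_unitUniform 2) hvar
  have hfalse : ∀ᵐ _ ∂unitUniform, False := by
    filter_upwards [hconst, ae_restrict_mem measurableSet_Ioc,
      Measure.ae_ne unitUniform (Real.exp (∫ y, Real.log y ∂unitUniform))] with x hx hmem hne
    exact hne (by rw [← hx, Real.exp_log hmem.1])
  simpa using hfalse.exists

lemma integral_log_unitUniform : ∫ x, Real.log x ∂unitUniform = -1 := by
  rw [← intervalIntegral.integral_of_le zero_le_one, integral_log]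
  simp

lemma identDistrib_log_of_hasLaw {u : Ω → ℝ} (hu : HasLaw u unitUniform P) :
    IdentDistrib (fun ω => Real.log (u ω)) Real.log P unitUniform :=
  (hu.identDistrib HasLaw.id).comp Real.measurable_log

lemma prod_le_exp_iff_sum_log_le {v : ℕ → ℝ} (hv : ∀ k, 0 < v k) (n : ℕ) (x : ℝ) :
    ∏ k ∈ Finset.range n, v k ≤ Real.exp x ↔ ∑ k ∈ Finset.range n, Real.log (v k) ≤ x := by
  rw [← Real.log_le_iff_le_exp (Finset.prod_pos fun k _ => hv k),
    Real.log_prod fun k _ => (hv k).ne']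

lemma tendsto_erlangTail_add (c : ℝ) :
    Tendsto (fun n : ℕ => erlangTail n (n + c)) atTop (𝓝 (1 / 2)) := by
  obtain ⟨Ω, _, P, w, -, hw, hindep, _⟩ := exists_iid ℕ unitUniform
  have hlog := fun k => identDistrib_log_of_hasLaw (hw k)
  have hclt := tendsto_measureReal_sum_le_mul_integral_add (Y := fun k ω => Real.log (w k ω))
    ((hlog 0).memLp_iff.2 (memLp_log_unitUniform 2))
    ((hlog 0).variance_eq.trans_ne variance_log_unitUniform_ne_zero)
    (hindep.comp (fun _ => Real.log) fun _ => Real.measurable_log)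
    (fun k => (hlog k).trans (hlog 0).symm) (1 - c)
  refine ((tendsto_add_atTop_iff_nat 1).2 hclt).congr' ?_
  filter_upwards [tendsto_natCast_atTop_atTop.eventually_ge_atTop (-c)] with n hn
  rw [(hlog 0).integral_eq, integral_log_unitUniform,
    ← max_eq_left (a := n + c) (b := 0) (by linarith), ← measureReal_prod_le_exp_neg hw hindep]
  refine measureReal_congr ?_
  filter_upwards [ae_all_iff.2 fun k => ae_mem_Ioc_of_hasLaw (hw k)] with ω hω
  have hiff := prod_le_exp_iff_sum_log_le (fun k => (hω k).1) (n + 1) (-(n + c))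
  refine propext (Iff.trans ?_ hiff.symm)
  rw [show -(n + c) = ((n + 1 : ℕ) : ℝ) * -1 + (1 - c) by push_cast; ring]
  rfl

end CentralLimit

section ErlangMedian

lemma half_le_erlangTail_add_two_thirds (n : ℕ) : 1 / 2 ≤ erlangTail n (n + 2 / 3) := by
  have hanti : Antitone fun n : ℕ => erlangTail n (n + 2 / 3) := by
    refine antitone_nat_of_succ_le fun n => ?_
    rw [Nat.cast_add_one, add_right_comm]
    exact erlangTail_succ_add_one_le (by positivity) le_rfl
  exact hanti.le_of_tendsto (tendsto_erlangTail_add _) n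

lemma erlangTail_add_log_two_le_half_of_lt {n : ℕ} (hn : n < 6) :
    erlangTail n (n + Real.log 2) ≤ 1 / 2 := by
  have hsum : ∑ k ∈ Finset.range (n + 1), ((n : ℝ) + Real.log 2) ^ k / (k.factorial : ℝ) ≤
      Real.exp n := by
    have hlog : Real.log 2 ≤ 0.6932 := by linarith [Real.log_two_lt_d9]
    calc ∑ k ∈ Finset.range (n + 1), ((n : ℝ) + Real.log 2) ^ k / (k.factorial : ℝ)
        ≤ ∑ k ∈ Finset.range (n + 1), ((n : ℝ) + 0.6932) ^ k / (k.factorial : ℝ) := by gcongr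
      _ ≤ (2.71828 : ℝ) ^ n := by
          interval_cases n <;> norm_num [Finset.sum_range_succ, Nat.factorial]
      _ ≤ Real.exp 1 ^ n := by
          gcongr
          linarith [Real.exp_one_gt_d9]
      _ = Real.exp n := Real.exp_one_pow n
  calc erlangTail n (n + Real.log 2)
      ≤ Real.exp (-(n + Real.log 2)) * Real.exp n := by
        rw [erlangTail]
        gcongr
    _ = 1 / 2 := by
        rw [← Real.exp_add, neg_add_rev, neg_add_cancel_right, Real.exp_neg,
          Real.exp_log two_pos, one_div]

lemma erlangTail_add_log_two_le_half (n : ℕ) : erlangTail n (n + Real.log 2) ≤ 1 / 2 := by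
  rcases lt_or_ge n 6 with hn | hn
  · exact erlangTail_add_log_two_le_half_of_lt hn
  · have hmono : MonotoneOn (fun n : ℕ => erlangTail n (n + Real.log 2)) (Set.Ici 6) := by
      refine monotoneOn_of_le_succ Set.ordConnected_Ici fun k _ hk _ => ?_
      have hk : (6 : ℝ) ≤ k := by exact_mod_cast hk
      have hlog := Real.log_two_gt_d9
      rw [Nat.succ_eq_succ, Nat.succ_eq_add_one, Nat.cast_add_one, add_right_comm]
      exact le_erlangTail_succ_add_one (by linarith) (by linarith)
    refine ge_of_tendsto (tendsto_erlangTail_add (Real.log 2)) ?_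
    filter_upwards [eventually_ge_atTop n] with k hk
    exact hmono hn (hn.trans hk) hk

lemma exists_erlangTail_eq_half (n : ℕ) :
    ∃ x ∈ Set.Icc ((n : ℝ) + 2 / 3) (n + Real.log 2), erlangTail n x = 1 / 2 :=
  intermediate_value_Icc' (by linarith [Real.log_two_gt_d9]) (continuous_erlangTail n).continuousOn
    ⟨erlangTail_add_log_two_le_half n, half_le_erlangTail_add_two_thirds n⟩

/-- The median of the sum of `n + 1` independent exponential variables of rate one. The paper's
`L̃` is `erlangMedian (L - 1)`. -/
noncomputable def erlangMedian (n : ℕ) : ℝ :=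
  (exists_erlangTail_eq_half n).choose

lemma erlangMedian_mem_Icc (n : ℕ) :
    erlangMedian n ∈ Set.Icc ((n : ℝ) + 2 / 3) (n + Real.log 2) :=
  (exists_erlangTail_eq_half n).choose_spec.1

lemma erlangTail_erlangMedian (n : ℕ) : erlangTail n (erlangMedian n) = 1 / 2 :=
  (exists_erlangTail_eq_half n).choose_spec.2

lemma erlangMedian_pos (n : ℕ) : 0 < erlangMedian n :=
  lt_of_lt_of_le (by positivity) (erlangMedian_mem_Icc n).1

end ErlangMedian

section ChainMagnitude

lemma chainMagnitude_eq_pow_mul_prod {Ω : Type*} (w : ℕ → Ω → ℝ) (τ : ℝ) (L : ℕ) :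
    chainMagnitude w τ L = fun ω => τ ^ L * ∏ k ∈ Finset.range L, w k ω := by
  ext ω
  simp [chainMagnitude, Finset.prod_mul_distrib]

variable {Ω : Type*} [MeasurableSpace Ω] {P : Measure Ω} {w : ℕ → Ω → ℝ} {τ : ℝ}

lemma isMedian_chainMagnitude_iff (hw : ∀ k, HasLaw (w k) unitUniform P) (hindep : iIndepFun w P)
    (hτ : 0 < τ) {L : ℕ} (hL : 1 ≤ L) {m : ℝ} :
    IsMedian P (chainMagnitude w τ L) m ↔
      m = Real.exp (L * Real.log τ - erlangMedian (L - 1)) := by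
  obtain ⟨n, rfl⟩ := Nat.exists_eq_add_of_le' hL
  rw [Nat.add_sub_cancel, chainMagnitude_eq_pow_mul_prod, isMedian_const_mul_iff (by positivity),
    isMedian_prod_iff hw hindep (erlangMedian_pos n) (erlangTail_erlangMedian n),
    div_eq_iff (by positivity), sub_eq_neg_add, Real.exp_add, Real.exp_nat_mul, Real.exp_log hτ]

lemma erlangMedian_pred_mem_Icc {L : ℕ} (hL : 1 ≤ L) :
    erlangMedian (L - 1) ∈ Set.Icc ((L : ℝ) - 1 / 3) (L - 1 + Real.log 2) := by
  obtain ⟨n, rfl⟩ := Nat.exists_eq_add_of_le' hL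
  have ⟨hlow, hupp⟩ := erlangMedian_mem_Icc n
  push_cast
  constructor <;> linarith

lemma tendsto_median_chainMagnitude_zero (hw : ∀ k, HasLaw (w k) unitUniform P)
    (hindep : iIndepFun w P) (hτ : 0 < τ) (hτe : τ < Real.exp 1) {m : ℕ → ℝ}
    (hm : ∀ L : ℕ, 1 ≤ L → IsMedian P (chainMagnitude w τ L) (m L)) :
    Tendsto m atTop (𝓝 0) := by
  have hlog : Real.log τ - 1 < 0 := sub_neg.2 ((Real.log_lt_iff_lt_exp hτ).2 hτe)
  have hexp : Tendsto (fun L : ℕ => Real.exp (L * (Real.log τ - 1) + 1 / 3)) atTop (𝓝 0) :=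
    Real.tendsto_exp_atBot.comp (tendsto_atBot_add_const_right _ _
      (tendsto_natCast_atTop_atTop.atTop_mul_const_of_neg hlog))
  refine squeeze_zero' ?_ ?_ hexp <;> filter_upwards [eventually_ge_atTop 1] with L hL <;>
    rw [(isMedian_chainMagnitude_iff hw hindep hτ hL).1 (hm L hL)]
  · positivity
  · gcongr
    linarith [(erlangMedian_pred_mem_Icc hL).1]

lemma median_chainMagnitude_exp_one_mem_Icc (hw : ∀ k, HasLaw (w k) unitUniform P)
    (hindep : iIndepFun w P) {L : ℕ} (hL : 1 ≤ L) {m : ℝ}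
    (hm : IsMedian P (chainMagnitude w (Real.exp 1) L) m) :
    m ∈ Set.Icc (Real.exp 1 / 2) (Real.exp (1 / 3)) := by
  have ⟨hlow, hupp⟩ := erlangMedian_pred_mem_Icc hL
  have hhalf : Real.exp 1 / 2 = Real.exp (1 - Real.log 2) := by
    rw [Real.exp_sub, Real.exp_log two_pos]
  rw [(isMedian_chainMagnitude_iff hw hindep (Real.exp_pos 1) hL).1 hm, Real.log_exp, mul_one,
    hhalf]
  constructor <;> refine Real.exp_le_exp.2 ?_ <;> linarith

lemma integrable_chainMagnitude_pow (hw : ∀ k, HasLaw (w k) unitUniform P) (τ : ℝ) (p L : ℕ) :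
    Integrable (fun ω => chainMagnitude w τ L ω ^ p) P := by
  have := (hw 0).isProbabilityMeasure
  simp only [chainMagnitude_eq_pow_mul_prod, mul_pow]
  refine Integrable.const_mul (Integrable.of_bound (C := 1)
    ((Finset.aemeasurable_fun_prod _ fun k _ => (hw k).aemeasurable).pow_const p
      ).aestronglyMeasurable ?_) _
  filter_upwards [ae_all_iff.2 fun k => ae_mem_Ioc_of_hasLaw (hw k)] with ω hω
  have hprod : 0 ≤ ∏ k ∈ Finset.range L, w k ω := Finset.prod_nonneg fun k _ => (hω k).1.le
  rw [norm_pow, Real.norm_of_nonneg hprod]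
  exact pow_le_one₀ hprod (Finset.prod_le_one (fun k _ => (hω k).1.le) fun k _ => (hω k).2)

lemma integral_chainMagnitude_pow (hw : ∀ k, HasLaw (w k) unitUniform P) (hindep : iIndepFun w P)
    (τ : ℝ) (p L : ℕ) :
    ∫ ω, chainMagnitude w τ L ω ^ p ∂P = (τ ^ p / (p + 1)) ^ L := by
  have hfactor : ∀ k, ∫ ω, (τ * w k ω) ^ p ∂P = τ ^ p / (p + 1) := fun k => by
    rw [integral_comp_of_hasLaw (hw k) (f := fun x => (τ * x) ^ p) (by fun_prop)]
    simp [mul_pow, div_eq_mul_inv]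
  have hprod := (hindep.precomp (Fin.val_injective (n := L))).integral_fun_prod_comp
    (f := fun _ x => (τ * x) ^ p) (fun k => (hw k).aemeasurable) fun _ => by fun_prop
  simp only [chainMagnitude, ← Finset.prod_pow]
  simpa only [Finset.prod_range, hfactor, Finset.prod_const, Finset.card_univ, Fintype.card_fin]
    using hprod

lemma ae_chainMagnitude_eq_exp (hw : ∀ k, HasLaw (w k) unitUniform P) (hτ : 0 < τ) :
    ∀ᵐ ω ∂P, ∀ L : ℕ, chainMagnitude w τ L ω =
      Real.exp (L * Real.log τ + ∑ k ∈ Finset.range L, Real.log (w k ω)) := by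
  filter_upwards [ae_all_iff.2 fun k => ae_mem_Ioc_of_hasLaw (hw k)] with ω hω L
  rw [chainMagnitude_eq_pow_mul_prod, Real.exp_add, Real.exp_nat_mul, Real.exp_log hτ,
    Real.exp_sum, Finset.prod_congr rfl fun k _ => Real.exp_log (hω k).1]

lemma ae_tendsto_sum_log_div (hw : ∀ k, HasLaw (w k) unitUniform P) (hindep : iIndepFun w P) :
    ∀ᵐ ω ∂P, Tendsto (fun L : ℕ => (∑ k ∈ Finset.range L, Real.log (w k ω)) / L) atTop
      (𝓝 (-1)) := by
  have hlog := fun k => identDistrib_log_of_hasLaw (hw k)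
  have hint : Integrable Real.log unitUniform :=
    memLp_one_iff_integrable.1 (memLp_log_unitUniform 1)
  have hlln := strong_law_ae_real (fun k ω => Real.log (w k ω)) ((hlog 0).integrable_iff.2 hint)
    (fun i j hij => (hindep.indepFun hij).comp Real.measurable_log Real.measurable_log)
    fun k => (hlog k).trans (hlog 0).symm
  rwa [(hlog 0).integral_eq, integral_log_unitUniform] at hlln

lemma ae_exists_tendsto_div_and_chainMagnitude_eq_exp (hw : ∀ k, HasLaw (w k) unitUniform P)
    (hindep : iIndepFun w P) (hτ : 0 < τ) :
    ∀ᵐ ω ∂P, ∃ s : ℕ → ℝ, Tendsto (fun L : ℕ => s L / L) atTop (𝓝 (Real.log τ - 1)) ∧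
      ∀ L : ℕ, chainMagnitude w τ L ω = Real.exp (s L) := by
  filter_upwards [ae_chainMagnitude_eq_exp hw hτ, ae_tendsto_sum_log_div hw hindep]
    with ω hexp hlim
  refine ⟨_, (hlim.const_add (Real.log τ)).congr' ?_, hexp⟩
  filter_upwards [eventually_ne_atTop 0] with L hL
  field_simp

lemma tendsto_exp_rpow_one_div {s : ℕ → ℝ} {a : ℝ}
    (hs : Tendsto (fun L : ℕ => s L / L) atTop (𝓝 a)) :
    Tendsto (fun L : ℕ => Real.exp (s L) ^ ((1 : ℝ) / L)) atTop (𝓝 (Real.exp a)) := by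
  simpa only [← Real.exp_mul, mul_one_div] using hs.rexp

lemma isLittleO_sub_mul_of_tendsto_div {s : ℕ → ℝ} {a : ℝ}
    (hs : Tendsto (fun L : ℕ => s L / L) atTop (𝓝 a)) :
    (fun L => s L - L * a) =o[atTop] fun L : ℕ => (L : ℝ) := by
  refine isLittleO_of_tendsto' ?_ ?_
  · filter_upwards [eventually_ne_atTop 0] with L hL hL₀
    exact absurd hL₀ (Nat.cast_ne_zero.2 hL)
  · rw [← sub_self a]
    refine (hs.sub_const a).congr' ?_
    filter_upwards [eventually_ne_atTop 0] with L hL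
    field_simp

lemma ae_tendsto_chainMagnitude_rpow (hw : ∀ k, HasLaw (w k) unitUniform P)
    (hindep : iIndepFun w P) (hτ : 0 < τ) :
    ∀ᵐ ω ∂P, Tendsto (fun L : ℕ => chainMagnitude w τ L ω ^ ((1 : ℝ) / L)) atTop
      (𝓝 (τ / Real.exp 1)) := by
  filter_upwards [ae_exists_tendsto_div_and_chainMagnitude_eq_exp hw hindep hτ] with ω ⟨s, hs, hexp⟩
  simp only [hexp]
  rw [← Real.exp_log hτ, ← Real.exp_sub]
  exact tendsto_exp_rpow_one_div hs

lemma ae_exists_isLittleO_chainMagnitude_eq_exp (hw : ∀ k, HasLaw (w k) unitUniform P)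
    (hindep : iIndepFun w P) (hτ : 0 < τ) :
    ∀ᵐ ω ∂P, ∃ r : ℕ → ℝ, r =o[atTop] (fun L : ℕ => (L : ℝ)) ∧
      ∀ L : ℕ, chainMagnitude w τ L ω = Real.exp (-(L * (1 - Real.log τ)) + r L) := by
  filter_upwards [ae_exists_tendsto_div_and_chainMagnitude_eq_exp hw hindep hτ] with ω ⟨s, hs, hexp⟩
  refine ⟨_, isLittleO_sub_mul_of_tendsto_div hs, fun L => (hexp L).trans ?_⟩
  ring_nf

end ChainMagnitude

theorem proposition3 {Ω : Type*} [MeasurableSpace Ω] (P : Measure Ω) [IsProbabilityMeasure P]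
    (w : ℕ → Ω → ℝ) (hmeas : ∀ k, Measurable (w k))
    (hunif : ∀ k, pdf.IsUniform (w k) (Set.Ioc (0 : ℝ) 1) P volume)
    (hindep : iIndepFun w P) :
    -- the median is unique, equals `exp (L log τ - L̃)`, and `L̃` depends on `L` only
    (∃ Lt : ℕ → ℝ,
      (∀ L : ℕ, 1 ≤ L →
        (L : ℝ) - 1 / 3 ≤ Lt L ∧ Lt L ≤ (L : ℝ) - 1 + Real.log 2) ∧
      ∀ τ : ℝ, 0 < τ → ∀ L : ℕ, 1 ≤ L → ∀ m : ℝ,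
        IsMedian P (chainMagnitude w τ L) m ↔ m = Real.exp ((L : ℝ) * Real.log τ - Lt L)) ∧
    -- `τ = 2`: vanishing median, mean one, exploding second moment
    ((∀ m : ℕ → ℝ, (∀ L : ℕ, 1 ≤ L → IsMedian P (chainMagnitude w 2 L) (m L)) →
        Tendsto m atTop (𝓝 0)) ∧
      (∀ L : ℕ, Integrable (chainMagnitude w 2 L) P ∧ ∫ ω, chainMagnitude w 2 L ω ∂P = 1) ∧
      (∀ L : ℕ, Integrable (fun ω => chainMagnitude w 2 L ω ^ 2) P) ∧
      Tendsto (fun L : ℕ => ∫ ω, chainMagnitude w 2 L ω ^ 2 ∂P) atTop atTop) ∧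
    -- `τ = √3`: vanishing median, second moment one
    ((∀ m : ℕ → ℝ, (∀ L : ℕ, 1 ≤ L → IsMedian P (chainMagnitude w (Real.sqrt 3) L) (m L)) →
        Tendsto m atTop (𝓝 0)) ∧
      (∀ L : ℕ, Integrable (fun ω => chainMagnitude w (Real.sqrt 3) L ω ^ 2) P ∧
        ∫ ω, chainMagnitude w (Real.sqrt 3) L ω ^ 2 ∂P = 1)) ∧
    -- `τ = e`: the median stays in a fixed compact subinterval of `(0, ∞)`
    (∀ L : ℕ, 1 ≤ L → ∀ m : ℝ, IsMedian P (chainMagnitude w (Real.exp 1) L) m →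
      Real.exp 1 / 2 ≤ m ∧ m ≤ Real.exp (1 / 3)) ∧
    -- almost sure behaviour: limit of the `L`-th root, and the resulting exponential rate
    (∀ τ : ℝ, 0 < τ → ∀ᵐ ω ∂P,
      Tendsto (fun L : ℕ => chainMagnitude w τ L ω ^ ((1 : ℝ) / (L : ℝ))) atTop
        (𝓝 (τ / Real.exp 1)) ∧
      ∃ r : ℕ → ℝ, r =o[atTop] (fun L : ℕ => (L : ℝ)) ∧
        ∀ L : ℕ, chainMagnitude w τ L ω
          = Real.exp (-((L : ℝ) * (1 - Real.log τ)) + r L)) := by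
  have hw := fun k => hasLaw_unitUniform_of_isUniform (hunif k)
  have hsq3 : √3 ^ 2 / (((2 : ℕ) : ℝ) + 1) = 1 := by norm_num
  have hsqrt3 : √3 < Real.exp 1 :=
    ((Real.sqrt_lt' two_pos).2 (by norm_num)).trans (by linarith [Real.exp_one_gt_d9])
  refine ⟨⟨fun L => erlangMedian (L - 1), fun L hL => erlangMedian_pred_mem_Icc hL,
      fun τ hτ L hL m => isMedian_chainMagnitude_iff hw hindep hτ hL⟩,
    ⟨fun m => tendsto_median_chainMagnitude_zero hw hindep two_pos
        (by linarith [Real.exp_one_gt_d9]),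
      fun L => ⟨?_, ?_⟩, integrable_chainMagnitude_pow hw 2 2, ?_⟩,
    ⟨fun m => tendsto_median_chainMagnitude_zero hw hindep (by positivity) hsqrt3,
      fun L => ⟨integrable_chainMagnitude_pow hw _ 2 L, ?_⟩⟩,
    fun L hL m => median_chainMagnitude_exp_one_mem_Icc hw hindep hL,
    fun τ hτ => (ae_tendsto_chainMagnitude_rpow hw hindep hτ).and
      (ae_exists_isLittleO_chainMagnitude_eq_exp hw hindep hτ)⟩
  · simpa using integrable_chainMagnitude_pow hw 2 1 L
  · simpa [one_add_one_eq_two] using integral_chainMagnitude_pow hw hindep 2 1 L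
  · simp only [integral_chainMagnitude_pow hw hindep]
    exact tendsto_pow_atTop_atTop_of_one_lt (by norm_num)
  · rw [integral_chainMagnitude_pow hw hindep, hsq3, one_pow]
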